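/- Let $\mathcal K$ be a locally presentable category and let $(\mathcal L,\mathcal R)$ be an accessible weak factorization system in $\mathcal K$; that is, a weak factorization system equipped with a functorial factorization $f = Rf\circ Lf$, with $Lf\in\mathcal L$ and $Rf\in\mathcal R$ for every morphism $f$, such that the factorization functor $F\colon\mathcal K^{\to}\to\mathcal K^{\to\to}$, $f\mapsto (Lf,Rf)$, from the category of morphisms of $\mathcal K$ to the category of composable pairs of morphisms of $\mathcal K$ is accessible (it preserves $\lambda$-filtered colimits for some regular cardinal $\lambda$). Let $\varepsilon_f=(\mathrm{id},Rf)\colon Lf\to f$ be the copoint of the endofunctor $L\colon\mathcal K^{\to}\to\mathcal K^{\to}$, and let $\mathrm{Coalg}(L)$ be the category of coalgebras of the copointed endofunctor $(L,\varepsilon)$: its objects are pairs $(f,a)$ of a morphism $f$ of $\mathcal K$ and a morphism $a\colon f\to Lf$ in $\mathcal K^{\to}$ with $\varepsilon_f\circ a=\mathrm{id}_f$, and its morphisms $(f,a)\to(g,b)$ are the morphisms $u\colon f\to g$ in $\mathcal K^{\to}$ with $b\circ u=L(u)\circ a$. Then $\mathrm{Coalg}(L)$ is locally presentable, and the forgetful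 functor $U\colon\mathrm{Coalg}(L)\to\mathcal K^{\to}$, $(f,a)\mapsto f$, is an accessible functor (i.e. a functor between accessible categories preserving $\lambda$-filtered colimits for some regular cardinal $\lambda$) which preserves all small colimits and whose full image, i.e. the full subcategory of $\mathcal K^{\to}$ on the objects $U(X)$ with $X\in\mathrm{Coalg}(L)$, is $\mathcal L$ (regarded as a full subcategory of $\mathcal K^{\to}$). In particular, $\mathcal L$ is the full image of a colimit-preserving accessible functor $\mathcal M\to\mathcal K^{\to}$ with $\mathcal M$ locally presentable. -/

import Mathlib

open CategoryTheory Limits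

universe w v u

/-- The full image of a functor `F : M ⥤ C`: the full subcategory of `C` (given as a property
of objects) consisting of the objects `F.obj X`. -/
def fullImage {M : Type*} [Category* M] {C : Type*} [Category* C] (F : M ⥤ C) :
    ObjectProperty C :=
  ObjectProperty.ofObj F.obj

/-- A class of morphisms of `C`, seen as a full subcategory of the arrow category of `C`. -/
def arrowClass {C : Type u} [Category.{v} C] (W : MorphismProperty C) :
    ObjectProperty (Arrow C) :=
  fun f => W f.hom

/-- An accessible functor, relative to the universe `w` of small sets: a functor between
accessible categories which preserves `κ`-filtered colimits for some regular cardinal `κ`. -/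
structure IsAccessibleFunctor {M : Type*} [Category* M] {C : Type*} [Category* C]
    (F : M ⥤ C) : Prop where
  source : IsAccessibleCategory.{w} M
  target : IsAccessibleCategory.{w} C
  preserves : Functor.IsAccessible.{w} F

/-- The coalgebras of a copointed endofunctor `(G, ε)`: objects `X` with a morphism
`X ⟶ G.obj X` which is a section of the copoint `ε`. Morphisms are those of coalgebras of the
endofunctor `G`. -/
abbrev CopointedCoalgebra {A : Type u} [Category.{v} A] (G : A ⥤ A) (ε : G ⟶ 𝟭 A) :
    Type (max u v) :=
  ObjectProperty.FullSubcategory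
    (fun X : Endofunctor.Coalgebra G => X.str ≫ ε.app X.V = 𝟙 X.V)

namespace FunctorialFact

variable {C : Type u} [Category.{v} C] {L R : MorphismProperty C}
  (F : MorphismProperty.FunctorialFactorizationData L R)

/-- The factorization functor `C^→ ⥤ C^→→`, which sends `f` to the composable pair
`(F.i.app f, F.p.app f)`. -/
def factorizationFunctor : Arrow C ⥤ ComposableArrows C 2 where
  obj f := ComposableArrows.mk₂ (F.i.app f) (F.p.app f)
  map {f g} φ := ComposableArrows.homMk₂ φ.left (F.Z.map φ) φ.right
    (F.i.naturality φ).symm (F.p.naturality φ).symm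
  map_id f := by
    apply ComposableArrows.hom_ext₂
    · rfl
    · exact F.Z.map_id f
    · rfl
  map_comp φ ψ := by
    apply ComposableArrows.hom_ext₂
    · rfl
    · exact F.Z.map_comp φ ψ
    · rfl

/-- The endofunctor `f ↦ F.i.app f` of the arrow category, given by the left parts of the
factorizations. -/
@[simps]
def leftFunctor : Arrow C ⥤ Arrow C where
  obj f := Arrow.mk (F.i.app f)
  map {f g} φ := Arrow.homMk φ.left (F.Z.map φ) (F.i.naturality φ)
  map_id f := by
    apply Arrow.hom_ext
    · rfl
    · exact F.Z.map_id f
  map_comp φ ψ := by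
    apply Arrow.hom_ext
    · rfl
    · exact F.Z.map_comp φ ψ

/-- The copoint of `leftFunctor F`: its component at `f` is the square with sides `F.i.app f`
and `f`, with the identity on top and `F.p.app f` at the bottom. -/
@[simps]
def leftCopoint : leftFunctor F ⟶ 𝟭 (Arrow C) where
  app f := Arrow.homMk (𝟙 f.left) (F.p.app f) (by
    have h := F.fac_app (f := f)
    simp only [Functor.id_obj]
    exact (Category.id_comp _).trans h.symm)
  naturality f g φ := by
    apply Arrow.hom_ext
    · exact (Category.comp_id φ.left).trans (Category.id_comp φ.left).symm
    · exact F.p.naturality φ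

/-- The category of coalgebras of the copointed endofunctor of left parts: an object is a
morphism `f` with a section of the square `leftCopoint`. -/
abbrev CoalgL : Type (max u v) := CopointedCoalgebra (leftFunctor F) (leftCopoint F)

/-- The forgetful functor from coalgebras to the arrow category. -/
abbrev forgetL : CoalgL F ⥤ Arrow C :=
  ObjectProperty.ι _ ⋙ Endofunctor.Coalgebra.forget (leftFunctor F)

end FunctorialFact

/-! A structure map goes out of its carrier, so it passes to colimits of carriers, and the forgetful
functor creates colimits. Local presentability then needs only a small strong generator of
presentable coalgebras.

Take `κ` regular and uncountable such that `A` is locally `κ`-presentable and `G` is `κ`-accessible.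
Coalgebras with `κ`-presentable carrier are `κ`-presentable (`isCardinalPresentable_of_carrier`) and
form an essentially small class. To see that there are enough of them, write the carrier of `Y` as a
`κ`-filtered colimit of `κ`-presentable objects `D j`. The structure map of `Y`, restricted to `D
j`, lifts to some `G (D n)` with `n` beyond `j`. Iterating gives a sequence with structure maps
shifted by one step. Its colimit is a genuine coalgebra over `Y`, still `κ`-presentable because `κ`
is uncountable (`exists_extension`). This yields `exists_factorization` and `exists_coequalizing`,
hence `isStrongGenerator`.

The theorem is the case of the arrow category and the left part of the factorization. A coalgebra
structure on `f` makes it a retract of its left part; conversely, lifting a left map against its own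
right part produces such a structure (`fullImage_forgetL`). -/

namespace CopointedCoalgebra

/-! ### Coalgebras of a copointed endofunctor -/

variable {A : Type u} [Category.{v} A] {G : A ⥤ A} {ε : G ⟶ 𝟭 A}

variable (G ε) in
/-- The forgetful functor from the coalgebras of a copointed endofunctor. -/
def forget : CopointedCoalgebra G ε ⥤ A :=
  ObjectProperty.ι _ ⋙ Endofunctor.Coalgebra.forget G

/-- The structure morphism of a coalgebra. -/
def str (X : CopointedCoalgebra G ε) : (forget G ε).obj X ⟶ G.obj ((forget G ε).obj X) :=
  X.obj.str

lemma str_copoint (X : CopointedCoalgebra G ε) :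
    str X ≫ ε.app ((forget G ε).obj X) = 𝟙 ((forget G ε).obj X) :=
  X.property

lemma str_map {X Y : CopointedCoalgebra G ε} (f : X ⟶ Y) :
    str X ≫ G.map ((forget G ε).map f) = (forget G ε).map f ≫ str Y :=
  f.hom.h

/-- A morphism of carriers compatible with the structure morphisms, as a morphism of
coalgebras. -/
def homMk {X Y : CopointedCoalgebra G ε} (f : (forget G ε).obj X ⟶ (forget G ε).obj Y)
    (h : str X ≫ G.map f = f ≫ str Y) : X ⟶ Y :=
  ObjectProperty.homMk ⟨f, h⟩

@[simp]
lemma forget_map_homMk {X Y : CopointedCoalgebra G ε}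
    (f : (forget G ε).obj X ⟶ (forget G ε).obj Y) (h : str X ≫ G.map f = f ≫ str Y) :
    (forget G ε).map (homMk f h) = f :=
  rfl

instance : (forget G ε).Faithful :=
  inferInstanceAs (ObjectProperty.ι _ ⋙ Endofunctor.Coalgebra.forget G).Faithful

lemma hom_ext {X Y : CopointedCoalgebra G ε} {f g : X ⟶ Y}
    (h : (forget G ε).map f = (forget G ε).map g) : f = g :=
  (forget G ε).map_injective h

/-- An isomorphism of carriers compatible with the structure morphisms, as an isomorphism of
coalgebras. -/
def isoMk {X Y : CopointedCoalgebra G ε} (e : (forget G ε).obj X ≅ (forget G ε).obj Y)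
    (h : str X ≫ G.map e.hom = e.hom ≫ str Y) : X ≅ Y where
  hom := homMk e.hom h
  inv := homMk e.inv (by
    rw [← cancel_epi e.hom, ← reassoc_of% h, ← G.map_comp, e.hom_inv_id, G.map_id,
      Category.comp_id, e.hom_inv_id_assoc])
  hom_inv_id := hom_ext e.hom_inv_id
  inv_hom_id := hom_ext e.inv_hom_id

instance : (forget G ε).ReflectsIsomorphisms where
  reflects {X Y} f hf := by
    have : f = (isoMk (X := X) (Y := Y) (asIso ((forget G ε).map f)) (str_map f)).hom :=
      hom_ext rfl
    rw [this]
    infer_instance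

/-- The coalgebra with given carrier and structure morphism. -/
abbrev of (V : A) (a : V ⟶ G.obj V) (h : a ≫ ε.app V = 𝟙 V) : CopointedCoalgebra G ε :=
  ⟨⟨V, a⟩, h⟩

/-! ### Colimits of coalgebras are computed on carriers -/

section Colimits

variable {J : Type*} [Category* J] {D : J ⥤ CopointedCoalgebra G ε}

/-- The structure morphism on a colimit of carriers of coalgebras. -/
def colimitStr {c : Cocone (D ⋙ forget G ε)} (hc : IsColimit c) : c.pt ⟶ G.obj c.pt :=
  hc.desc
    { pt := G.obj c.pt
      ι :=
        { app j := str (D.obj j) ≫ G.map (c.ι.app j)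
          naturality i j f := by
            have h₁ := (reassoc_of% (str_map (D.map f))) (G.map (c.ι.app j))
            have h₂ := c.w f
            dsimp at h₁ h₂ ⊢
            rw [← h₁, ← G.map_comp, h₂, Category.comp_id] } }

lemma ι_colimitStr {c : Cocone (D ⋙ forget G ε)} (hc : IsColimit c) (j : J) :
    c.ι.app j ≫ colimitStr hc = str (D.obj j) ≫ G.map (c.ι.app j) :=
  hc.fac _ _

/-- A colimit cocone of carriers, lifted to a cocone of coalgebras. -/
def liftedCocone {c : Cocone (D ⋙ forget G ε)} (hc : IsColimit c) : Cocone D where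
  pt := of c.pt (colimitStr hc) (hc.hom_ext fun j ↦ by
    have h₁ := ε.naturality (c.ι.app j)
    dsimp at h₁
    rw [reassoc_of% (ι_colimitStr hc j), h₁, reassoc_of% (str_copoint (D.obj j)), Category.comp_id])
  ι :=
    { app j := homMk (Y := of c.pt (colimitStr hc) _) (c.ι.app j) (ι_colimitStr hc j).symm
      naturality i j f := hom_ext (c.ι.naturality f) }

/-- A cocone of coalgebras is colimiting if the cocone of carriers is. -/
def isColimitOfForget {c : Cocone D} (hc : IsColimit ((forget G ε).mapCocone c)) :
    IsColimit c where
  desc s := homMk (hc.desc ((forget G ε).mapCocone s)) (hc.hom_ext fun j ↦ by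
    have h₁ := str_map (c.ι.app j)
    have h₂ := str_map (s.ι.app j)
    have h₃ := hc.fac ((forget G ε).mapCocone s) j
    have h₄ := hc.fac_assoc ((forget G ε).mapCocone s) j (str s.pt)
    dsimp at h₁ h₂ h₃ h₄ ⊢
    rw [h₄, ← h₂, ← h₃, G.map_comp, reassoc_of% h₁])
  fac s j := hom_ext (hc.fac ((forget G ε).mapCocone s) j)
  uniq s m hm := hom_ext (hc.uniq ((forget G ε).mapCocone s) _
    fun j ↦ congrArg (forget G ε).map (hm j))

/-- The lifted cocone is colimiting. -/
def isColimitLiftedCocone {c : Cocone (D ⋙ forget G ε)} (hc : IsColimit c) :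
    IsColimit (liftedCocone hc) :=
  isColimitOfForget hc

instance hasColimitsOfShape [HasColimitsOfShape J A] :
    HasColimitsOfShape J (CopointedCoalgebra G ε) where
  has_colimit _ := ⟨_, isColimitLiftedCocone (colimit.isColimit _)⟩

/-- The lifted cocone is a colimit whose image is the chosen colimit of carriers, and preservation
may be checked on one colimit cocone. -/
instance preservesColimitsOfShape_forget [HasColimitsOfShape J A] :
    PreservesColimitsOfShape J (forget G ε) where
  preservesColimit := preservesColimit_of_preserves_colimit_cocone
    (isColimitLiftedCocone (colimit.isColimit _)) (colimit.isColimit _)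

instance hasColimitsOfSize [HasColimitsOfSize.{w, w} A] :
    HasColimitsOfSize.{w, w} (CopointedCoalgebra G ε) where

instance preservesColimitsOfSize_forget [HasColimitsOfSize.{w, w} A] :
    PreservesColimitsOfSize.{w, w} (forget G ε) where

end Colimits

instance [LocallySmall.{w} A] : LocallySmall.{w} (CopointedCoalgebra G ε) :=
  locallySmall_of_faithful (forget G ε)

/-- A coalgebra is `κ`-presentable if its carrier is and the endofunctor is `κ`-accessible. -/
lemma isCardinalPresentable_of_carrier (κ : Cardinal.{w}) [Fact κ.IsRegular]
    [HasColimitsOfSize.{w, w} A] [G.IsCardinalAccessible κ] (X : CopointedCoalgebra G ε)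
    [IsCardinalPresentable ((forget G ε).obj X) κ] : IsCardinalPresentable X κ where
  preservesColimitOfShape J _ _ := ⟨fun {D} ↦ ⟨fun {c} hc ↦ by
    have := isFiltered_of_isCardinalFiltered J κ
    have hG := G.preservesColimitsOfShape_of_isCardinalAccessible κ J
    have hc' := isColimitOfPreserves (forget G ε) hc
    have hc'' := isColimitOfPreserves G hc'
    refine ⟨Types.FilteredColimit.isColimitOf' _ _ (fun f ↦ ?_) (fun j f g h ↦ ?_)⟩
    · obtain ⟨j, f', hf'⟩ := IsCardinalPresentable.exists_hom_of_isColimit κ hc'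
        ((forget G ε).map f)
      -- The lift `f'` need not be a coalgebra morphism. Its defect is a pair of maps into `G (D j)`
      -- that agree in the colimit, hence already at a later stage.
      obtain ⟨k, a, ha⟩ := IsCardinalPresentable.exists_eq_of_isColimit' κ hc''
        (str X ≫ G.map f') (f' ≫ str (D.obj j)) (by
          have h₁ := str_map f
          have h₂ := str_map (c.ι.app j)
          dsimp at hf' h₁ h₂ ⊢
          rw [Category.assoc, Category.assoc, ← G.map_comp, h₂, reassoc_of% hf', hf', h₁])
      refine ⟨k, homMk (f' ≫ (forget G ε).map (D.map a)) ?_, hom_ext ?_⟩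
      · have h₁ := str_map (D.map a)
        dsimp at ha h₁ ⊢
        simp only [Category.assoc] at ha
        rw [G.map_comp, ha, h₁, Category.assoc]
      · have h₁ := ((forget G ε).mapCocone c).w a
        dsimp at h₁ hf' ⊢
        rw [Functor.map_comp, forget_map_homMk, Category.assoc, h₁, hf']
    · obtain ⟨k, a, ha⟩ := IsCardinalPresentable.exists_eq_of_isColimit' κ hc'
        ((forget G ε).map f) ((forget G ε).map g) (congrArg (forget G ε).map h)
      exact ⟨k, a, hom_ext ha⟩⟩⟩

variable {A : Type u} [Category.{v} A] {G : A ⥤ A} {ε : G ⟶ 𝟭 A}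
  {J : Type*} [Category* J] {D : J ⥤ A} {Y : CopointedCoalgebra G ε}

/-! ### Sequences with shifted structure maps -/

section Sequence

variable {X : ℕ → A} {f : ∀ n, X n ⟶ X (n + 1)} {a : ∀ n, X n ⟶ G.obj (X (n + 1))}
  {c : Cocone (Functor.ofSequence f)} (hc : IsColimit c)

/-- The component of a cocone over a sequence. -/
abbrev leg (c : Cocone (Functor.ofSequence f)) (n : ℕ) : X n ⟶ c.pt := c.ι.app n

lemma map_leg (c : Cocone (Functor.ofSequence f)) (n : ℕ) :
    f n ≫ leg c (n + 1) = leg c n := by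
  have h := c.w (homOfLE (Nat.le_add_right n 1))
  rwa [Functor.ofSequence_map_homOfLE_succ] at h

include hc in
lemma sequence_hom_ext {Z : A} {g h : c.pt ⟶ Z} (H : ∀ n, leg c n ≫ g = leg c n ≫ h) : g = h :=
  hc.hom_ext H

/-- The morphism from the colimit of a sequence which is given by a compatible family. -/
def sequenceDesc {Z : A} (g : ∀ n, X n ⟶ Z) (hg : ∀ n, f n ≫ g (n + 1) = g n) : c.pt ⟶ Z :=
  hc.desc (Cocone.mk Z (NatTrans.ofSequence g (fun n ↦ by
    rw [Functor.ofSequence_map_homOfLE_succ]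
    exact (hg n).trans (Category.comp_id _).symm)))

lemma leg_sequenceDesc {Z : A} (g : ∀ n, X n ⟶ Z) (hg : ∀ n, f n ≫ g (n + 1) = g n) (n : ℕ) :
    leg c n ≫ sequenceDesc hc g hg = g n :=
  hc.fac _ n

variable (h₁ : ∀ n, f n ≫ a (n + 1) = a n ≫ G.map (f (n + 1)))

/-- The structure morphism on the colimit of a sequence which is given by structure morphisms
shifted by one step. -/
def sequenceStr : c.pt ⟶ G.obj c.pt :=
  sequenceDesc hc (fun n ↦ a n ≫ G.map (leg c (n + 1))) (fun n ↦ by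
    rw [reassoc_of% (h₁ n), ← G.map_comp, map_leg])

lemma leg_sequenceStr (n : ℕ) :
    leg c n ≫ sequenceStr hc h₁ = a n ≫ G.map (leg c (n + 1)) :=
  leg_sequenceDesc hc (fun n ↦ a n ≫ G.map (leg c (n + 1))) _ n

variable (h₂ : ∀ n, a n ≫ ε.app (X (n + 1)) = f n)

-- The shifted structure maps are sections of the copoint only up to the transition maps, which the
-- colimit absorbs.
include h₂ in
lemma sequenceStr_copoint : sequenceStr hc h₁ ≫ ε.app c.pt = 𝟙 c.pt :=
  sequence_hom_ext hc (fun n ↦ by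
    have h := ε.naturality (leg c (n + 1))
    dsimp only [Functor.id_obj, Functor.id_map] at h
    rw [reassoc_of% (leg_sequenceStr hc h₁ n), h, reassoc_of% (h₂ n), map_leg]
    exact (Category.comp_id _).symm)

lemma sequenceStr_map (g : ∀ n, X n ⟶ (forget G ε).obj Y)
    (hg : ∀ n, f n ≫ g (n + 1) = g n) (hg' : ∀ n, a n ≫ G.map (g (n + 1)) = g n ≫ Y.str) :
    sequenceStr hc h₁ ≫ G.map (sequenceDesc hc g hg) = sequenceDesc hc g hg ≫ Y.str :=
  sequence_hom_ext hc (fun n ↦ by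
    rw [reassoc_of% (leg_sequenceStr hc h₁ n), ← G.map_comp, leg_sequenceDesc,
      reassoc_of% (leg_sequenceDesc hc g hg n), hg'])

/-- The coalgebra on the colimit of a sequence which is given by structure morphisms shifted by
one step. -/
def sequentialColimit : CopointedCoalgebra G ε :=
  of c.pt (sequenceStr hc h₁) (sequenceStr_copoint hc h₁ h₂)

/-- A compatible family of morphisms to a coalgebra gives a morphism from the colimit
coalgebra. -/
def sequentialColimitDesc (g : ∀ n, X n ⟶ (forget G ε).obj Y)
    (hg : ∀ n, f n ≫ g (n + 1) = g n) (hg' : ∀ n, a n ≫ G.map (g (n + 1)) = g n ≫ Y.str) :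
    sequentialColimit hc h₁ h₂ ⟶ Y :=
  homMk (X := sequentialColimit hc h₁ h₂) (sequenceDesc hc g hg) (sequenceStr_map hc h₁ g hg hg')

end Sequence

/-! ### Partial coalgebra structures and their extension -/

/-- A coalgebra structure along a morphism of a diagram `D` over the carrier of a coalgebra `Y`:
a morphism `src ⟶ tgt` in the index category, with a lift of the structure morphism of `Y` to a
morphism from `D.obj src` to `G.obj (D.obj tgt)`. -/
structure PartialCoalgebra (α : D ⟶ (Functor.const J).obj ((forget G ε).obj Y)) where
  /-- the index of the domain of the partial structure morphism -/
  src : J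
  /-- the index of the object to which the endofunctor is applied in the codomain -/
  tgt : J
  /-- the comparison morphism -/
  hom : src ⟶ tgt
  /-- the partial structure morphism -/
  str : D.obj src ⟶ G.obj (D.obj tgt)
  str_map : str ≫ G.map (α.app tgt) = α.app src ≫ Y.str
  str_copoint : str ≫ ε.app (D.obj tgt) = D.map hom

namespace PartialCoalgebra

variable {α : D ⟶ (Functor.const J).obj ((forget G ε).obj Y)}

section Extension

variable (κ : Cardinal.{w}) [Fact κ.IsRegular] [IsCardinalFiltered J κ] [EssentiallySmall.{w} J]
  [G.IsCardinalAccessible κ] (hα : IsColimit (Cocone.mk _ α))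
include hα

/-- Since `G` preserves the colimit, presentability lifts the restricted structure map to some `G (D
k)`. The copoint law holds after mapping to `Y`, so it holds after moving from `k` to a later index.
-/
lemma exists_of_src (j : J) [IsCardinalPresentable (D.obj j) κ] :
    ∃ (n : J) (p : j ⟶ n) (a : D.obj j ⟶ G.obj (D.obj n)),
      a ≫ G.map (α.app n) = α.app j ≫ Y.str ∧ a ≫ ε.app (D.obj n) = D.map p := by
  have := isFiltered_of_isCardinalFiltered J κ
  have := G.preservesColimitsOfShape_of_isCardinalAccessible_of_essentiallySmall κ J
  obtain ⟨k, a, ha⟩ := IsCardinalPresentable.exists_hom_of_isColimit κ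
    (isColimitOfPreserves G hα) (α.app j ≫ Y.str)
  obtain ⟨m, p, q, h⟩ := IsCardinalPresentable.exists_eq_of_isColimit κ hα
    (a ≫ ε.app (D.obj k)) (𝟙 (D.obj j)) (by
      have h := ε.naturality (α.app k)
      dsimp at ha h ⊢
      rw [Category.assoc, ← h, reassoc_of% ha, CopointedCoalgebra.str_copoint, Category.comp_id,
        Category.id_comp])
  refine ⟨m, q, a ≫ G.map (D.map p), ?_, ?_⟩
  · have h := α.naturality p
    dsimp at ha h ⊢
    rw [Category.comp_id] at h
    rw [Category.assoc, ← G.map_comp, h, ha]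
  · have h' := ε.naturality (D.map p)
    dsimp at h' h ⊢
    rw [Category.assoc, h', ← Category.assoc, h, Category.id_comp]

/-- The two maps out of `P` to be identified agree in `G Y`, so a further step in the diagram makes
them equal without spoiling the lift from `exists_of_src`. -/
lemma exists_of_src_extending {P : A} [IsCardinalPresentable P κ] {j : J}
    [IsCardinalPresentable (D.obj j) κ] (x : P ⟶ D.obj j) (b : P ⟶ G.obj (D.obj j))
    (hb : b ≫ G.map (α.app j) = x ≫ α.app j ≫ Y.str) :
    ∃ (n : J) (p : j ⟶ n) (a : D.obj j ⟶ G.obj (D.obj n)),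
      a ≫ G.map (α.app n) = α.app j ≫ Y.str ∧ a ≫ ε.app (D.obj n) = D.map p ∧
      b ≫ G.map (D.map p) = x ≫ a := by
  have := G.preservesColimitsOfShape_of_isCardinalAccessible_of_essentiallySmall κ J
  obtain ⟨m, p, a, ha, ha'⟩ := exists_of_src κ hα j
  obtain ⟨n, q, hq⟩ := IsCardinalPresentable.exists_eq_of_isColimit' κ
    (isColimitOfPreserves G hα) (b ≫ G.map (D.map p)) (x ≫ a) (by
      have h := α.naturality p
      dsimp at ha h hb ⊢
      rw [Category.comp_id] at h
      rw [Category.assoc, Category.assoc, ← G.map_comp, h, ha, hb])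
  have h := α.naturality q
  have h' := ε.naturality (D.map q)
  dsimp at h h' hq
  rw [Category.comp_id] at h
  refine ⟨n, p ≫ q, a ≫ G.map (D.map q), ?_, ?_, ?_⟩
  · rw [Category.assoc, ← G.map_comp, h, ha]
  · rw [Category.assoc, h', reassoc_of% ha', D.map_comp]
  · rw [D.map_comp, G.map_comp, ← Category.assoc, hq, Category.assoc]

lemma exists_next (s : PartialCoalgebra α) [IsCardinalPresentable (D.obj s.src) κ]
    [IsCardinalPresentable (D.obj s.tgt) κ] :
    ∃ (n : J) (p : s.tgt ⟶ n) (a : D.obj s.tgt ⟶ G.obj (D.obj n)),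
      a ≫ G.map (α.app n) = α.app s.tgt ≫ Y.str ∧ a ≫ ε.app (D.obj n) = D.map p ∧
      s.str ≫ G.map (D.map p) = D.map s.hom ≫ a :=
  exists_of_src_extending κ hα (D.map s.hom) s.str (by
    have h := α.naturality s.hom
    dsimp at h
    rw [Category.comp_id] at h
    rw [s.str_map, reassoc_of% h])

variable [hD : ∀ j, IsCardinalPresentable (D.obj j) κ]

/-- The extension of a partial coalgebra structure by one step. -/
noncomputable def next (s : PartialCoalgebra α) : PartialCoalgebra α where
  src := s.tgt
  tgt := (exists_next κ hα s).choose
  hom := (exists_next κ hα s).choose_spec.choose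
  str := (exists_next κ hα s).choose_spec.choose_spec.choose
  str_map := (exists_next κ hα s).choose_spec.choose_spec.choose_spec.1
  str_copoint := (exists_next κ hα s).choose_spec.choose_spec.choose_spec.2.1

/-- This is the compatibility that lets the successive structure maps descend to the colimit of the
sequence. -/
lemma str_next (s : PartialCoalgebra α) :
    s.str ≫ G.map (D.map (next κ hα s).hom) = D.map s.hom ≫ (next κ hα s).str :=
  (exists_next κ hα s).choose_spec.choose_spec.choose_spec.2.2

/-- The iterated extensions of a partial coalgebra structure. -/
noncomputable def iterate (s : PartialCoalgebra α) : ℕ → PartialCoalgebra α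
  | 0 => s
  | n + 1 => next κ hα (iterate s n)

/-- A partial coalgebra over `Y` extends to a coalgebra over `Y` with `κ`-presentable carrier. -/
lemma exists_extension [IsCardinalLocallyPresentable A κ] (hκ : Cardinal.aleph0 < κ)
    (s : PartialCoalgebra α) :
    ∃ (Q : CopointedCoalgebra G ε) (_ : IsCardinalPresentable ((forget G ε).obj Q) κ)
      (r : Q ⟶ Y) (t : D.obj s.tgt ⟶ (forget G ε).obj Q),
      t ≫ (forget G ε).map r = α.app s.tgt ∧
      s.str ≫ G.map t = (D.map s.hom ≫ t) ≫ Q.str := by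
  have : HasColimitsOfSize.{0, 0} A := hasColimitsOfSizeShrink.{0, 0, w, w} A
  let f (n : ℕ) : D.obj (iterate κ hα s n).src ⟶ D.obj (iterate κ hα s (n + 1)).src :=
    D.map (iterate κ hα s n).hom
  let a (n : ℕ) : D.obj (iterate κ hα s n).src ⟶ G.obj (D.obj (iterate κ hα s (n + 1)).src) :=
    (iterate κ hα s n).str
  let hc := colimit.isColimit (Functor.ofSequence f)
  have h₁ (n : ℕ) : f n ≫ a (n + 1) = a n ≫ G.map (f (n + 1)) :=
    (str_next κ hα (iterate κ hα s n)).symm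
  have h₂ (n : ℕ) : a n ≫ ε.app _ = f n := (iterate κ hα s n).str_copoint
  let g (n : ℕ) : D.obj (iterate κ hα s n).src ⟶ (forget G ε).obj Y :=
    α.app (iterate κ hα s n).src
  have hg (n : ℕ) : f n ≫ g (n + 1) = g n :=
    (α.naturality (iterate κ hα s n).hom).trans (Category.comp_id _)
  have hg' (n : ℕ) : a n ≫ G.map (g (n + 1)) = g n ≫ Y.str := (iterate κ hα s n).str_map
  let Q := sequentialColimit hc h₁ h₂
  -- Stage 1 rather than 0: the first extension has source `s.tgt`.
  let t : D.obj s.tgt ⟶ (forget G ε).obj Q := leg (colimit.cocone (Functor.ofSequence f)) 1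
  refine ⟨Q, ?_, sequentialColimitDesc hc h₁ h₂ g hg hg', t, ?_, ?_⟩
  · have (n : ℕ) : IsCardinalPresentable ((Functor.ofSequence f).obj n) κ := hD _
    -- The strict inequality `ℵ₀ < κ` matters here: a sequence is then a `κ`-small diagram.
    have hN : HasCardinalLT (Arrow ℕ) κ := by
      have : Countable (Arrow ℕ) :=
        Function.Injective.countable (f := fun φ : Arrow ℕ ↦ (φ.left, φ.right))
          (fun φ ψ h ↦ by
            obtain ⟨i, j, φ⟩ := φ
            obtain ⟨i', j', ψ⟩ := ψ
            obtain ⟨rfl, rfl⟩ := Prod.mk.inj h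
            obtain rfl := Subsingleton.elim φ ψ
            rfl)
      refine lt_of_le_of_lt (b := Cardinal.aleph0) ?_ (by simpa using hκ)
      simp
    exact isCardinalPresentable_of_isColimit _ hc κ hN
  · exact leg_sequenceDesc hc g hg 1
  · have h := leg_sequenceStr hc h₁ 0
    rw [← map_leg] at h
    exact h.symm

end Extension

end PartialCoalgebra

/-! ### A small strong generator of coalgebras -/

section Presentable

variable {κ : Cardinal.{w}} [Fact κ.IsRegular] [IsCardinalLocallyPresentable A κ]

-- Carriers range over a small set up to isomorphism, each has a small set of structure maps, and
-- structures transport along isomorphisms.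
variable (G ε κ) in
lemma essentiallySmall_inverseImage_forget :
    ObjectProperty.EssentiallySmall.{w}
      ((isCardinalPresentable A κ).inverseImage (forget G ε)) := by
  obtain ⟨P, _, -, hP⟩ :=
    ObjectProperty.EssentiallySmall.exists_small_le.{w} (isCardinalPresentable A κ)
  let T := Σ V : Subtype P, { a : V.1 ⟶ G.obj V.1 // a ≫ ε.app V.1 = 𝟙 V.1 }
  refine ⟨ObjectProperty.ofObj (fun x : T ↦ of x.1.1 x.2.1 x.2.2), inferInstance, fun X hX ↦ ?_⟩
  obtain ⟨V, hV, ⟨e⟩⟩ := hP _ hX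
  let a : V ⟶ G.obj V := e.inv ≫ X.str ≫ G.map e.hom
  have ha : a ≫ ε.app V = 𝟙 V := by
    have h := ε.naturality e.hom
    dsimp at h
    simp only [a, Category.assoc]
    rw [h, reassoc_of% (str_copoint X), e.inv_hom_id]
  refine ⟨of V a ha, ObjectProperty.ofObj_apply _ (⟨⟨V, hV⟩, ⟨a, ha⟩⟩ : T),
    ⟨isoMk (Y := of V a ha) e (e.hom_inv_id_assoc (X.str ≫ G.map e.hom)).symm⟩⟩

variable [G.IsCardinalAccessible κ]

/-- A morphism from a `κ`-presentable object to the carrier of a coalgebra factors through a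
coalgebra with `κ`-presentable carrier. -/
lemma exists_factorization (hκ : Cardinal.aleph0 < κ) {P : A} [IsCardinalPresentable P κ]
    (f : P ⟶ (forget G ε).obj Y) :
    ∃ (Q : CopointedCoalgebra G ε) (_ : IsCardinalPresentable ((forget G ε).obj Q) κ)
      (r : Q ⟶ Y) (t : P ⟶ (forget G ε).obj Q), t ≫ (forget G ε).map r = f := by
  obtain ⟨J, _, _, ⟨d⟩⟩ :=
    (isCardinalFilteredGenerator_isCardinalPresentable A κ).exists_colimitsOfShape
      ((forget G ε).obj Y)
  have (j : J) : IsCardinalPresentable (d.diag.obj j) κ := d.prop_diag_obj j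
  obtain ⟨j, x, rfl⟩ := IsCardinalPresentable.exists_hom_of_isColimit κ d.isColimit f
  obtain ⟨n, p, a, h₁, h₂⟩ := PartialCoalgebra.exists_of_src κ d.isColimit j
  obtain ⟨Q, hQ, r, t, ht, -⟩ :=
    PartialCoalgebra.exists_extension κ d.isColimit hκ ⟨j, n, p, a, h₁, h₂⟩
  refine ⟨Q, hQ, r, x ≫ d.diag.map p ≫ t, ?_⟩
  have h := d.ι.naturality p
  dsimp at ht h ⊢
  rw [Category.comp_id] at h
  rw [Category.assoc, Category.assoc, ht, h]

/-- Two morphisms to a coalgebra with `κ`-presentable carrier which become equal in a coalgebra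
`Y` already become equal in a coalgebra with `κ`-presentable carrier over `Y`. -/
lemma exists_coequalizing (hκ : Cardinal.aleph0 < κ) {X : CopointedCoalgebra G ε}
    [IsCardinalPresentable ((forget G ε).obj X) κ] (m : X ⟶ Y)
    {P : A} [IsCardinalPresentable P κ] (f g : P ⟶ (forget G ε).obj X)
    (h : f ≫ (forget G ε).map m = g ≫ (forget G ε).map m) :
    ∃ (Q : CopointedCoalgebra G ε) (_ : IsCardinalPresentable ((forget G ε).obj Q) κ)
      (r : Q ⟶ Y) (t : X ⟶ Q), t ≫ r = m ∧
      f ≫ (forget G ε).map t = g ≫ (forget G ε).map t := by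
  obtain ⟨J, _, _, ⟨d⟩⟩ :=
    (isCardinalFilteredGenerator_isCardinalPresentable A κ).exists_colimitsOfShape
      ((forget G ε).obj Y)
  have (j : J) : IsCardinalPresentable (d.diag.obj j) κ := d.prop_diag_obj j
  have nat {j k : J} (p : j ⟶ k) : d.diag.map p ≫ d.ι.app k = d.ι.app j :=
    (d.ι.naturality p).trans (Category.comp_id _)
  obtain ⟨i, x, hx⟩ := IsCardinalPresentable.exists_hom_of_isColimit κ d.isColimit
    ((forget G ε).map m)
  dsimp at hx
  obtain ⟨j, q, hq⟩ := IsCardinalPresentable.exists_eq_of_isColimit' κ d.isColimit (f ≫ x) (g ≫ x)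
    (by dsimp; rw [Category.assoc, Category.assoc, hx, h])
  obtain ⟨y, hy⟩ : ∃ y, y = x ≫ d.diag.map q := ⟨_, rfl⟩
  have hym : y ≫ d.ι.app j = (forget G ε).map m := by rw [hy, Category.assoc, nat, hx]
  have hfg : f ≫ y = g ≫ y := by rw [hy, ← Category.assoc, hq, Category.assoc]
  -- The partial structure on `D j` is made to extend that of `X` along `y`, so that the induced map
  -- from `X` is a coalgebra morphism.
  obtain ⟨n, p, a, h₁, h₂, h₃⟩ := PartialCoalgebra.exists_of_src_extending κ d.isColimit y
    (X.str ≫ G.map y) (by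
      have h := reassoc_of% hym
      rw [Category.assoc, ← G.map_comp, hym, str_map, ← h])
  obtain ⟨Q, hQ, r, t, ht, ht'⟩ :=
    PartialCoalgebra.exists_extension κ d.isColimit hκ ⟨j, n, p, a, h₁, h₂⟩
  dsimp at ht ht'
  refine ⟨Q, hQ, r, homMk (y ≫ d.diag.map p ≫ t) ?_, hom_ext ?_, ?_⟩
  · rw [Category.assoc] at h₃
    rw [G.map_comp, G.map_comp, reassoc_of% h₃, ht']
    simp only [Category.assoc]
  · rw [Functor.map_comp, forget_map_homMk, Category.assoc, Category.assoc, ht, nat, hym]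
  · rw [forget_map_homMk, reassoc_of% hfg]

variable (G ε κ) in
/-- The coalgebras with `κ`-presentable carrier form a strong generator. -/
lemma isStrongGenerator (hκ : Cardinal.aleph0 < κ) :
    ((isCardinalPresentable A κ).inverseImage (forget G ε)).IsStrongGenerator := by
  have hA := (isCardinalFilteredGenerator_isCardinalPresentable A κ).isStrongGenerator
  rw [ObjectProperty.isStrongGenerator_iff]
  refine ⟨fun X Y f g h ↦ hom_ext (hA.isSeparating _ _ fun P hP p ↦ ?_), fun X Y i _ hi ↦ ?_⟩
  · have : IsCardinalPresentable P κ := hP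
    obtain ⟨Q, hQ, r, t, rfl⟩ := exists_factorization hκ p
    rw [Category.assoc, Category.assoc, ← Functor.map_comp, ← Functor.map_comp, h Q hQ r]
  -- Preservation of monomorphisms by `forget` is not automatic; the lifting hypothesis `hi` is used
  -- as well.
  · have : Mono ((forget G ε).map i) := by
      rw [hA.isSeparating.mono_iff]
      intro P hP p q hpq
      have : IsCardinalPresentable P κ := hP
      have : IsCardinalPresentable (P ⨿ P) κ := by
        have (j : Discrete WalkingPair) : IsCardinalPresentable ((pair P P).obj j) κ := by
          rcases j with ⟨_ | _⟩ <;> exact hP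
        exact isCardinalPresentable_of_isColimit _ (colimit.isColimit (pair P P)) κ
          (hasCardinalLT_of_finite _ _ hκ.le)
      -- The coproduct makes `p` and `q` factor through the same coalgebra.
      obtain ⟨Q, hQ, s, t, hst⟩ := exists_factorization hκ (coprod.desc p q)
      have hp : (coprod.inl ≫ t) ≫ (forget G ε).map s = p := by
        rw [Category.assoc, hst, coprod.inl_desc]
      have hq : (coprod.inr ≫ t) ≫ (forget G ε).map s = q := by
        rw [Category.assoc, hst, coprod.inr_desc]
      obtain ⟨Q', hQ', r, u, hu, hu'⟩ := exists_coequalizing hκ (s ≫ i) (coprod.inl ≫ t)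
        (coprod.inr ≫ t) (by
          rw [Functor.map_comp, ← Category.assoc, hp, ← Category.assoc, hq, hpq])
      -- Lifting `r` through `i` turns the coequalizing over `Y` into one over `X`, since `i` is
      -- monic on coalgebras.
      obtain ⟨r', rfl⟩ := hi Q' hQ' r
      have hs : u ≫ r' = s := by
        rw [← cancel_mono i, Category.assoc]
        exact hu
      rw [← hp, ← hq, ← hs, Functor.map_comp, ← Category.assoc, hu', Category.assoc]
    have : IsIso ((forget G ε).map i) := hA.isIso_of_mono _ (fun P hP p ↦ by
      have : IsCardinalPresentable P κ := hP
      obtain ⟨Q, hQ, r, t, rfl⟩ := exists_factorization hκ p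
      obtain ⟨r', rfl⟩ := hi Q hQ r
      exact ⟨t ≫ (forget G ε).map r', by simp⟩)
    exact isIso_of_reflects_iso i (forget G ε)

variable (G ε κ) in
/-- Coalgebras of an accessible copointed endofunctor are locally presentable. -/
lemma isCardinalLocallyPresentable (hκ : Cardinal.aleph0 < κ) :
    IsCardinalLocallyPresentable (CopointedCoalgebra G ε) κ := by
  have hP := isStrongGenerator G ε κ hκ
  have := essentiallySmall_inverseImage_forget G ε κ
  obtain ⟨Q, _, hQ, hQ'⟩ := ObjectProperty.EssentiallySmall.exists_small_le.{w}
    ((isCardinalPresentable A κ).inverseImage (forget G ε))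
  rw [IsCardinalLocallyPresentable.iff_exists_isStrongGenerator]
  refine ⟨Q, inferInstance, ?_, fun X hX ↦ ?_⟩
  · rw [ObjectProperty.isStrongGenerator_iff]
    refine ⟨fun X Y f g h ↦ hP.isSeparating _ _ fun Z hZ p ↦ ?_,
      fun X Y i _ hi ↦ hP.isIso_of_mono i fun Z hZ p ↦ ?_⟩
    · obtain ⟨Z', hZ', ⟨e⟩⟩ := hQ' _ hZ
      rw [← cancel_epi e.inv]
      simpa using h Z' hZ' (e.inv ≫ p)
    · obtain ⟨Z', hZ', ⟨e⟩⟩ := hQ' _ hZ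
      obtain ⟨q, hq⟩ := hi Z' hZ' (e.inv ≫ p)
      dsimp only at hq
      refine ⟨e.hom ≫ q, ?_⟩
      dsimp only
      rw [Category.assoc, hq, e.hom_inv_id_assoc]
  · have : IsCardinalPresentable ((forget G ε).obj X) κ := hQ _ hX
    exact isCardinalPresentable_of_carrier κ X

end Presentable

end CopointedCoalgebra

/-! ### Local presentability of the arrow category -/

namespace CategoryTheory.Arrow

variable {C : Type u} [Category.{w} C] {κ : Cardinal.{w}} [Fact κ.IsRegular]

instance [HasColimitsOfSize.{w, w} C] : HasColimitsOfSize.{w, w} (Arrow C) where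

/-- Morphisms from an identity are morphisms to the domain. -/
def coyonedaIdIso (P : C) :
    Arrow.leftFunc ⋙ coyoneda.obj (Opposite.op P) ≅
      coyoneda.obj (Opposite.op (Arrow.mk (𝟙 P))) :=
  NatIso.ofComponents (fun f ↦ Equiv.toIso
    { toFun (p : P ⟶ f.left) := Arrow.homMk p (p ≫ f.hom) (Category.id_comp (p ≫ f.hom)).symm
      invFun p := p.left
      left_inv _ := rfl
      right_inv p := by
        apply Arrow.hom_ext
        · rfl
        · exact p.w.trans (Category.id_comp _) }) (by
      intro f g φ
      ext (p : P ⟶ f.left)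
      apply Arrow.hom_ext
      · rfl
      · change (p ≫ φ.left) ≫ g.hom = (p ≫ f.hom) ≫ φ.right
        rw [Category.assoc, Category.assoc]
        exact congrArg (p ≫ ·) φ.w)

/-- Morphisms from the morphism with initial domain are morphisms to the codomain. -/
noncomputable def coyonedaInitialIso [HasInitial C] (P : C) :
    Arrow.rightFunc ⋙ coyoneda.obj (Opposite.op P) ≅
      coyoneda.obj (Opposite.op (Arrow.mk (initial.to P))) :=
  NatIso.ofComponents (fun f ↦ Equiv.toIso
    { toFun p := Arrow.homMk (initial.to _) p (initial.hom_ext _ _)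
      invFun p := p.right
      left_inv _ := rfl
      right_inv p := by
        apply Arrow.hom_ext
        · exact initial.hom_ext _ _
        · rfl }) (by
      intro f g φ
      ext p
      apply Arrow.hom_ext
      · exact initial.hom_ext _ _
      · rfl)

instance [HasColimitsOfSize.{w, w} C] (P : C) [IsCardinalPresentable P κ] :
    IsCardinalPresentable (Arrow.mk (𝟙 P)) κ where
  preservesColimitOfShape J _ _ :=
    have := preservesColimitsOfShape_of_isCardinalPresentable P κ J
    preservesColimitsOfShape_of_natIso (coyonedaIdIso P)

instance [HasColimitsOfSize.{w, w} C] [HasInitial C] (P : C) [IsCardinalPresentable P κ] :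
    IsCardinalPresentable (Arrow.mk (initial.to P)) κ where
  preservesColimitOfShape J _ _ :=
    have := preservesColimitsOfShape_of_isCardinalPresentable P κ J
    preservesColimitsOfShape_of_natIso (coyonedaInitialIso P)

/-- The arrow category of a locally `κ`-presentable category is locally `κ`-presentable. -/
instance [IsCardinalLocallyPresentable C κ] : IsCardinalLocallyPresentable (Arrow C) κ := by
  have : HasInitial C := 
    have := hasColimitsOfSizeShrink.{0, 0, w, w} C
    inferInstance
  obtain ⟨P, _, hP, hP'⟩ := (IsCardinalLocallyPresentable.iff_exists_isStrongGenerator C κ).1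
    inferInstance
  rw [IsCardinalLocallyPresentable.iff_exists_isStrongGenerator]
  -- Identities of generators test domains, and maps from the initial object to generators test
  -- codomains.
  refine ⟨ObjectProperty.ofObj (fun X : Subtype P ↦ Arrow.mk (𝟙 X.1)) ⊔
    ObjectProperty.ofObj (fun X : Subtype P ↦ Arrow.mk (initial.to X.1)), inferInstance, ?_, ?_⟩
  · rw [ObjectProperty.isStrongGenerator_iff]
    have sep {f g : Arrow C} (φ ψ : f ⟶ g)
        (h : ∀ (T : Arrow C), (ObjectProperty.ofObj (fun X : Subtype P ↦ Arrow.mk (𝟙 X.1)) ⊔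
          ObjectProperty.ofObj (fun X : Subtype P ↦ Arrow.mk (initial.to X.1))) T →
          ∀ p : T ⟶ f, p ≫ φ = p ≫ ψ) : φ = ψ := by
      apply Arrow.hom_ext
      · refine hP.isSeparating _ _ fun X hX p ↦ ?_
        exact congrArg CommaMorphism.left (h _ (Or.inl ⟨⟨X, hX⟩⟩)
          (Arrow.homMk p (p ≫ f.hom) (by simp) : Arrow.mk (𝟙 X) ⟶ f))
      · refine hP.isSeparating _ _ fun X hX p ↦ ?_
        exact congrArg CommaMorphism.right (h _ (Or.inr ⟨⟨X, hX⟩⟩)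
          (Arrow.homMk (initial.to _) p (initial.hom_ext _ _) : Arrow.mk (initial.to X) ⟶ f))
    refine ⟨fun f g φ ψ h ↦ sep φ ψ h, fun f g i _ hi ↦ ?_⟩
    have : Mono i.left := by
      rw [hP.isSeparating.mono_iff]
      intro X hX p q h
      have h' : (Arrow.homMk p (p ≫ f.hom) (by simp) : Arrow.mk (𝟙 X) ⟶ f) =
          Arrow.homMk q (q ≫ f.hom) (by simp) := by
        rw [← cancel_mono i]
        apply Arrow.hom_ext
        · exact h
        · have h₂ := i.w
          change (p ≫ f.hom) ≫ i.right = (q ≫ f.hom) ≫ i.right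
          rw [Category.assoc, Category.assoc, ← h₂, reassoc_of% h]
      exact congrArg CommaMorphism.left h'
    have : Mono i.right := by
      rw [hP.isSeparating.mono_iff]
      intro X hX p q h
      have h' : (Arrow.homMk (initial.to _) p (initial.hom_ext _ _) :
          Arrow.mk (initial.to X) ⟶ f) =
          Arrow.homMk (initial.to _) q (initial.hom_ext _ _) := by
        rw [← cancel_mono i]
        apply Arrow.hom_ext
        · exact initial.hom_ext _ _
        · exact h
      exact congrArg CommaMorphism.right h'
    have : IsIso i.left := hP.isIso_of_mono _ fun X hX p ↦ by
      obtain ⟨q, hq⟩ := hi _ (Or.inl ⟨⟨X, hX⟩⟩)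
        (Arrow.homMk p (p ≫ g.hom) (by simp) : Arrow.mk (𝟙 X) ⟶ g)
      exact ⟨q.left, congrArg CommaMorphism.left hq⟩
    have : IsIso i.right := hP.isIso_of_mono _ fun X hX p ↦ by
      obtain ⟨q, hq⟩ := hi _ (Or.inr ⟨⟨X, hX⟩⟩)
        (Arrow.homMk (initial.to _) p (initial.hom_ext _ _) : Arrow.mk (initial.to X) ⟶ g)
      exact ⟨q.right, congrArg CommaMorphism.right hq⟩
    exact Arrow.isIso_of_isIso_left_of_isIso_right i
  · rintro _ (⟨⟨X, hX⟩⟩ | ⟨⟨X, hX⟩⟩)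
    · have : IsCardinalPresentable X κ := hP' _ hX
      exact inferInstanceAs (IsCardinalPresentable (Arrow.mk (𝟙 X)) κ)
    · have : IsCardinalPresentable X κ := hP' _ hX
      exact inferInstanceAs (IsCardinalPresentable (Arrow.mk (initial.to X)) κ)

end CategoryTheory.Arrow

/-! ### The left part of the factorization and the left class -/

namespace FunctorialFact

variable {C : Type u} [Category.{v} C] {L R : MorphismProperty C}
  (F : MorphismProperty.FunctorialFactorizationData L R)

/-- The left part of a functorial factorization is accessible if the factorization is. -/
lemma isCardinalAccessible_leftFunctor (κ : Cardinal.{w}) [Fact κ.IsRegular]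
    [HasColimitsOfSize.{w, w} C] [(factorizationFunctor F).IsCardinalAccessible κ] :
    (leftFunctor F).IsCardinalAccessible κ where
  preservesColimitOfShape J _ _ := ⟨fun {D} ↦ ⟨fun {c} hc ↦ by
    have := (factorizationFunctor F).preservesColimitsOfShape_of_isCardinalAccessible κ J
    -- The domain of the left part is that of `f`; its codomain is the middle object, read off by
    -- evaluating the factorization at 1.
    exact ⟨Comma.fstSndJointlyReflectColimit
      (isColimitOfPreserves (Arrow.leftFunc : Arrow C ⥤ C) hc :)
      (isColimitOfPreserves
        (factorizationFunctor F ⋙ (evaluation (Fin 3) C).obj 1) hc)⟩⟩⟩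

/-- The morphisms which carry a coalgebra structure for the left part of a functorial
factorization of a weak factorization system are those of the left class. -/
lemma fullImage_forgetL [L.IsWeakFactorizationSystem R] :
    fullImage (forgetL F) = arrowClass L := by
  ext f
  constructor
  · rintro ⟨⟨⟨f, a⟩, ha⟩⟩
    have : L.IsStableUnderRetracts := by
      rw [← MorphismProperty.IsWeakFactorizationSystem.llp (W₁ := L) (W₂ := R)]
      infer_instance
    exact MorphismProperty.of_retract
      (show RetractArrow f.hom (F.i.app f) from
        { i := a
          r := (leftCopoint F).app f
          retract := ha }) (F.hi f)
  · intro hf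
    let i : f.left ⟶ F.Z.obj f := F.i.app f
    let p : F.Z.obj f ⟶ f.right := F.p.app f
    -- A diagonal in the square from `f` to its own right part, with identity at the bottom, is the
    -- required section.
    have : HasLiftingProperty f.hom p := MorphismProperty.hasLiftingProperty_of_wfs _ _ hf (F.hp f)
    have sq : CommSq i f.hom p (𝟙 _) := ⟨F.fac_app.trans (Category.comp_id f.hom).symm⟩
    have ha : (Arrow.homMk (𝟙 _) sq.lift
        ((Category.id_comp i).trans sq.fac_left.symm) : f ⟶ (leftFunctor F).obj f) ≫
        (leftCopoint F).app f = 𝟙 f := by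
      apply Arrow.hom_ext
      · exact Category.id_comp _
      · exact sq.fac_right
    exact ⟨(⟨⟨f, _⟩, ha⟩ : CoalgL F)⟩

end FunctorialFact

theorem mainTheorem8 {K : Type u} [Category.{w} K] [IsLocallyPresentable.{w} K]
    (L R : MorphismProperty K) [L.IsWeakFactorizationSystem R]
    (F : MorphismProperty.FunctorialFactorizationData L R)
    (hF : Functor.IsAccessible.{w} (FunctorialFact.factorizationFunctor F)) :
    IsLocallyPresentable.{w} (FunctorialFact.CoalgL F) ∧
      PreservesColimitsOfSize.{w, w} (FunctorialFact.forgetL F) ∧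
      IsAccessibleFunctor.{w} (FunctorialFact.forgetL F) ∧
      fullImage (FunctorialFact.forgetL F) = arrowClass L := by
  obtain ⟨κ₁, _, _⟩ := IsLocallyPresentable.exists_cardinal.{w} K
  obtain ⟨κ₂, _, _⟩ := Functor.IsAccessible.exists_cardinal
    (F := FunctorialFact.factorizationFunctor F)
  obtain ⟨κ, _, h₀, h₁, h₂⟩ : ∃ (κ : Cardinal.{w}) (_ : Fact κ.IsRegular),
      Cardinal.aleph0 < κ ∧ κ₁ ≤ κ ∧ κ₂ ≤ κ :=
    -- A successor of an infinite cardinal is regular, and here also uncountable.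
    ⟨Order.succ (max Cardinal.aleph0 (max κ₁ κ₂)), ⟨Cardinal.isRegular_succ (le_max_left _ _)⟩,
      Order.lt_succ_of_le (le_max_left _ _),
      (le_max_left _ _).trans ((le_max_right _ _).trans (Order.le_succ _)),
      (le_max_right _ _).trans ((le_max_right _ _).trans (Order.le_succ _))⟩
  have := IsCardinalLocallyPresentable.of_le K h₁
  have := (FunctorialFact.factorizationFunctor F).isCardinalAccessible_of_le h₂
  have := FunctorialFact.isCardinalAccessible_leftFunctor F κ
  have hC : IsLocallyPresentable.{w} (FunctorialFact.CoalgL F) :=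
    ⟨κ, inferInstance, CopointedCoalgebra.isCardinalLocallyPresentable _ _ κ h₀⟩
  have hK : IsLocallyPresentable.{w} (Arrow K) := ⟨κ, inferInstance, inferInstance⟩
  have hU : PreservesColimitsOfSize.{w, w} (FunctorialFact.forgetL F) :=
    inferInstanceAs (PreservesColimitsOfSize.{w, w} (CopointedCoalgebra.forget _ _))
  exact ⟨hC, hU,
    { source := inferInstance
      target := inferInstance
      preserves := Functor.isAccessible_of_isCardinalAccessible _ κ },
    FunctorialFact.fullImage_forgetL F⟩
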